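/- Let $\alpha\in(0,1)\cup(1,2)$ and let $X$ be a symmetric $\alpha$-stable random variable with Lévy measure $\nu(dx)=|x|^{-\alpha-1}\,dx$ on $\mathbb{R}$, i.e. a real random variable with $$\mathbb{E}\,e^{itX}=\exp\Big(\int_{\mathbb{R}}\psi(t,x)\,|x|^{-\alpha-1}\,dx\Big)\quad(t\in\mathbb{R}),\qquad \psi(t,x)=\begin{cases}e^{itx}-1,&\alpha\in(0,1),\\ e^{itx}-1-itx,&\alpha\in(1,2).\end{cases}$$ Let $y>0$. If $\alpha\in(0,1)$, then $$\mathbb{P}(X\ge y)\le\frac{4}{\alpha y^{\alpha}}\qquad\text{and}\qquad \mathbb{P}(|X|>y)\le\frac{8}{\alpha y^{\alpha}}.$$ For every $\alpha\in(0,1)\cup(1,2)$, $$\mathbb{P}(X\ge y)\ge\frac{1}{2}\cdot\frac{1}{2+\alpha y^{\alpha}}.$$ -/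

import Mathlib

open MeasureTheory

/-- The Lévy measure `ν(dx) = |x| ^ (-α - 1) dx` on the real line (both one-sided constants
equal to `1`). The single point `x = 0` is Lebesgue-null, so the value there is irrelevant. -/
noncomputable def symmLevyMeasure (α : ℝ) : Measure ℝ :=
  volume.withDensity (fun x => ENNReal.ofReal (|x| ^ (-α - 1)))

/-- The integrand of the Lévy–Khintchine exponent of a strictly `α`-stable law:
`e^{itx} - 1` for `α < 1`, and the compensated `e^{itx} - 1 - itx` for `α > 1`. -/
noncomputable def stableKernel (α t x : ℝ) : ℂ :=
  if α < 1 then Complex.exp (Complex.I * t * x) - 1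
  else Complex.exp (Complex.I * t * x) - 1 - Complex.I * t * x

/-- `X` is a symmetric `α`-stable random variable with Lévy measure `|x| ^ (-α - 1) dx`
(used for `α ∈ (0, 1) ∪ (1, 2)`): its characteristic function is
`E e^{itX} = exp (∫ ψ(t, x) ν(dx))`. -/
structure IsSymmStable {Ω : Type*} [MeasurableSpace Ω] (α : ℝ) (X : Ω → ℝ)
    (P : Measure Ω) : Prop where
  aemeasurable : AEMeasurable X P
  charFun_eq : ∀ t : ℝ, charFun (P.map X) t =
    Complex.exp (∫ x, stableKernel α t x ∂(symmLevyMeasure α))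

/-! By symmetry the odd part of the kernel, compensator included, integrates to zero, so X has
characteristic function exp(-K(t)) with K(t) = ∫ (1 - cos tx) ν(dx) (`integral_stableKernel`), and X
is symmetric. One-sided tails are therefore half of two-sided ones.

Upper bounds, α < 1: bounding 1 - cos by the smaller of t²x²/2 and 2 gives K(t) ≤ (4/α)|t|^α
(`levyExponent_le`). As 1 - exp(-K) ≤ K, averaging over |t| ≤ 2/r controls P(|X| > r) by 8/(α r^α)
(`measureReal_abs_gt_le_of_charFun`).

Lower bound: X is the weak limit of sums of n i.i.d. jumps with law ν restricted to |x| ≥ c_n and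
normalized, where c_n makes the mass equal to n. With l = ν(|x| ≥ y) = 2/(α y^α), some jump reaches
y with probability 1 - (1 - l/n)^n, and by symmetry the remaining terms undo it at most half the
time (`univ_le_two_mul_conv_convPow`). In the limit 2 P(|X| ≥ y) ≥ 1 - exp(-l) ≥ l/(1 + l), and
halving twice gives the claim. -/

open Filter Topology

/-! ### Symmetric measures, convolution powers and the one-big-jump inequality -/

/-- The convolution of two symmetric measures is symmetric. -/
lemma isNegInvariant_conv (μ ν : Measure ℝ) [SFinite μ] [SFinite ν] [μ.IsNegInvariant]
    [ν.IsNegInvariant] : (μ ∗ ν).IsNegInvariant := by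
  constructor
  have h := Measure.map_conv_addMonoidHom (μ := μ) (ν := ν) (negAddMonoidHom : ℝ →+ ℝ)
    measurable_neg
  have hμ : μ.map (negAddMonoidHom : ℝ →+ ℝ) = μ := Measure.map_neg_eq_self μ
  have hν : ν.map (negAddMonoidHom : ℝ →+ ℝ) = ν := Measure.map_neg_eq_self ν
  rw [hμ, hν] at h
  exact h

/-- The restriction of a symmetric measure to a symmetric set is symmetric. -/
lemma isNegInvariant_restrict (μ : Measure ℝ) [μ.IsNegInvariant] {s : Set ℝ}
    (hs : MeasurableSet s) (hneg : ∀ x, -x ∈ s ↔ x ∈ s) : (μ.restrict s).IsNegInvariant := by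
  constructor
  have h := Measure.restrict_map (μ := μ) (f := Neg.neg) measurable_neg hs
  have hpre : (Neg.neg ⁻¹' s : Set ℝ) = s := Set.ext hneg
  rw [Measure.map_neg_eq_self, hpre] at h
  exact h.symm

lemma isNegInvariant_smul (μ : Measure ℝ) [μ.IsNegInvariant] (c : ENNReal) :
    (c • μ).IsNegInvariant := by
  constructor
  rw [Measure.neg, Measure.map_smul, Measure.map_neg_eq_self]

/-- The `n`-fold convolution power of a measure on the real line. -/
noncomputable def convPow (ρ : Measure ℝ) : ℕ → Measure ℝ
  | 0 => Measure.dirac 0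
  | n + 1 => ρ ∗ convPow ρ n

instance isFiniteMeasure_convPow (ρ : Measure ℝ) [IsFiniteMeasure ρ] (n : ℕ) :
    IsFiniteMeasure (convPow ρ n) := by
  induction n with
  | zero => unfold convPow; infer_instance
  | succ n ih => unfold convPow; infer_instance

instance isProbabilityMeasure_convPow (ρ : Measure ℝ) [IsProbabilityMeasure ρ] (n : ℕ) :
    IsProbabilityMeasure (convPow ρ n) := by
  induction n with
  | zero => unfold convPow; infer_instance
  | succ n ih => unfold convPow; infer_instance

instance isNegInvariant_convPow (ρ : Measure ℝ) [IsFiniteMeasure ρ] [ρ.IsNegInvariant] (n : ℕ) :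
    (convPow ρ n).IsNegInvariant := by
  induction n with
  | zero =>
    constructor
    rw [Measure.neg, convPow, Measure.map_dirac' measurable_neg, neg_zero]
  | succ n ih => unfold convPow; exact isNegInvariant_conv _ _

lemma charFun_convPow (ρ : Measure ℝ) [IsFiniteMeasure ρ] (n : ℕ) (t : ℝ) :
    charFun (convPow ρ n) t = charFun ρ t ^ n := by
  induction n with
  | zero => simp [convPow]
  | succ n ih => rw [convPow, charFun_conv, ih, pow_succ']

lemma conv_univ (μ ν : Measure ℝ) [SFinite ν] :
    (μ ∗ ν) Set.univ = μ Set.univ * ν Set.univ := by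
  rw [Measure.conv, Measure.map_apply (by fun_prop) MeasurableSet.univ, Set.preimage_univ,
    ← Set.univ_prod_univ, Measure.prod_prod]

lemma measurableSet_le_abs (y : ℝ) : MeasurableSet {x : ℝ | y ≤ |x|} :=
  measurableSet_le measurable_const (by fun_prop)

/-- Adding an independent symmetric summand to a variable of absolute value at least `y` keeps the
absolute value above `y` with probability at least one half. -/
lemma mul_univ_le_two_mul_conv {y : ℝ} (ρ σ : Measure ℝ) [SFinite ρ] [SFinite σ]
    [σ.IsNegInvariant] (hρ : ∀ᵐ x ∂ρ, y ≤ |x|) :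
    ρ Set.univ * σ Set.univ ≤ 2 * (ρ ∗ σ) {x | y ≤ |x|} := by
  -- Since (x + w) + (x - w) = 2x, at least one of |x + w|, |x - w| is ≥ |x|; the two events have
  -- equal σ-mass by symmetry.
  have key : ∀ x : ℝ, y ≤ |x| → σ Set.univ ≤ 2 * σ {w | y ≤ |x + w|} := by
    intro x hx
    have h1 : σ {w | y ≤ |x - w|} = σ {w | y ≤ |x + w|} := by
      rw [← Measure.measure_preimage_neg σ {w | y ≤ |x + w|}]
      rfl
    calc σ Set.univ ≤ σ ({w | y ≤ |x + w|} ∪ {w | y ≤ |x - w|}) := by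
          refine measure_mono fun w _ => ?_
          by_contra hw
          simp only [Set.mem_union, Set.mem_ofPred_eq, not_or, not_le] at hw
          have h2 : |(x + w) + (x - w)| ≤ |x + w| + |x - w| := abs_add_le _ _
          have h3 : (x + w) + (x - w) = 2 * x := by ring
          rw [h3, abs_mul, abs_two] at h2
          linarith [hw.1, hw.2]
      _ ≤ _ := measure_union_le _ _
      _ = _ := by rw [h1, two_mul]
  have hconv : (ρ ∗ σ) {x | y ≤ |x|} = ∫⁻ x, σ {w | y ≤ |x + w|} ∂ρ := by
    rw [Measure.conv, Measure.map_apply (by fun_prop) (measurableSet_le_abs y),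
      Measure.prod_apply (measurable_add (measurableSet_le_abs y))]
    rfl
  calc ρ Set.univ * σ Set.univ = ∫⁻ _, σ Set.univ ∂ρ := by rw [lintegral_const, mul_comm]
    _ ≤ ∫⁻ x, 2 * σ {w | y ≤ |x + w|} ∂ρ := lintegral_mono_ae (hρ.mono key)
    _ = 2 * (ρ ∗ σ) {x | y ≤ |x|} := by
      rw [hconv, lintegral_const_mul' _ _ (by simp)]

/-- A one-big-jump inequality of Lévy type: the sum of `n` independent symmetric summands and an
independent symmetric remainder is large with at least half the probability that one of the
summands is large. -/
lemma univ_le_two_mul_conv_convPow {y : ℝ} (ρ : Measure ℝ) [IsProbabilityMeasure ρ]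
    [ρ.IsNegInvariant] (n : ℕ) (τ : Measure ℝ) [IsFiniteMeasure τ] [τ.IsNegInvariant] :
    τ Set.univ ≤ 2 * (τ ∗ convPow ρ n) {x | y ≤ |x|} +
      τ Set.univ * ρ {x | y ≤ |x|}ᶜ ^ n := by
  induction n generalizing τ with
  | zero => simp
  | succ n ih =>
    have hF := measurableSet_le_abs y
    set F := {x : ℝ | y ≤ |x|} with hFdef
    have := isNegInvariant_restrict ρ hF.compl (by simp [F])
    have := isNegInvariant_conv τ (ρ.restrict Fᶜ)
    have := isNegInvariant_conv τ (convPow ρ n)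
    -- Split on the size of one summand. If small, it joins the remainder, which is why τ must vary
    -- in the induction and need not have mass one; if large, everything else is a symmetric
    -- perturbation of it.
    have hsplit : τ ∗ convPow ρ (n + 1) =
        (τ ∗ ρ.restrict Fᶜ) ∗ convPow ρ n + ρ.restrict F ∗ (τ ∗ convPow ρ n) := by
      have hρ : convPow ρ (n + 1) = (ρ.restrict F + ρ.restrict Fᶜ) ∗ convPow ρ n := by
        rw [convPow, Measure.restrict_add_restrict_compl hF]
      rw [hρ, Measure.add_conv, Measure.conv_add, ← Measure.conv_assoc, ← Measure.conv_assoc,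
        ← Measure.conv_assoc, Measure.conv_comm τ (ρ.restrict F), add_comm]
    have h1 := ih (τ ∗ ρ.restrict Fᶜ)
    have h2 := mul_univ_le_two_mul_conv (y := y) (ρ.restrict F) (τ ∗ convPow ρ n)
      (ae_restrict_mem hF)
    simp only [conv_univ, Measure.restrict_apply_univ, measure_univ, mul_one] at h1 h2
    calc τ Set.univ = τ Set.univ * ρ Fᶜ + ρ F * τ Set.univ := by
          rw [mul_comm (ρ F), ← mul_add, add_comm, measure_add_measure_compl hF,
            measure_univ (μ := ρ), mul_one]
      _ ≤ _ := add_le_add h1 h2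
      _ = _ := by
        rw [hsplit, Measure.add_apply]
        ring

/-! ### Integration against the Lévy measure -/

lemma integrable_comp_abs {f : ℝ → ℝ} (hf : IntegrableOn f (Set.Ioi 0)) :
    Integrable (fun x => f |x|) := by
  have hIoi : IntegrableOn (fun x => f |x|) (Set.Ioi 0) :=
    hf.congr_fun (fun x hx => by rw [abs_of_pos hx]) measurableSet_Ioi
  have hIic : IntegrableOn (fun x => f |x|) (Set.Iic 0) := by
    have h := ((integrableOn_Ici_iff_integrableOn_Ioi (μ := volume)).mpr hIoi).comp_neg
    simpa using h
  rw [← integrableOn_univ, ← Set.Iic_union_Ioi (a := (0 : ℝ))]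
  exact hIic.union hIoi

lemma measurable_levyDensity (α : ℝ) :
    Measurable fun x : ℝ => ENNReal.ofReal (|x| ^ (-α - 1)) := by fun_prop

lemma integrable_symmLevyMeasure_iff {E : Type*} [NormedAddCommGroup E] [NormedSpace ℝ E]
    {α : ℝ} {g : ℝ → E} :
    Integrable g (symmLevyMeasure α) ↔ Integrable fun x => |x| ^ (-α - 1) • g x := by
  rw [symmLevyMeasure, integrable_withDensity_iff_integrable_smul' (measurable_levyDensity α)
    (by simp)]
  simp_rw [ENNReal.toReal_ofReal (Real.rpow_nonneg (abs_nonneg _) _)]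

lemma integral_symmLevyMeasure {E : Type*} [NormedAddCommGroup E] [NormedSpace ℝ E]
    {α : ℝ} (g : ℝ → E) :
    ∫ x, g x ∂symmLevyMeasure α = ∫ x, |x| ^ (-α - 1) • g x := by
  rw [symmLevyMeasure, integral_withDensity_eq_integral_toReal_smul (measurable_levyDensity α)
    (by simp)]
  simp_rw [ENNReal.toReal_ofReal (Real.rpow_nonneg (abs_nonneg _) _)]

instance isNegInvariant_symmLevyMeasure (α : ℝ) : (symmLevyMeasure α).IsNegInvariant := by
  constructor
  ext s hs
  rw [Measure.neg, Measure.map_apply measurable_neg hs, symmLevyMeasure, withDensity_apply _ hs,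
    withDensity_apply _ (measurable_neg hs), ← lintegral_indicator hs,
    ← lintegral_indicator (measurable_neg hs), ← lintegral_neg_eq_self (μ := volume)
      (s.indicator fun x => ENNReal.ofReal (|x| ^ (-α - 1)))]
  refine lintegral_congr fun x => ?_
  by_cases hx : -x ∈ s <;> simp [Set.indicator, hx]

lemma ae_ne_zero_symmLevyMeasure (α : ℝ) : ∀ᵐ x ∂symmLevyMeasure α, x ≠ 0 :=
  (withDensity_absolutelyContinuous _ _).ae_le (Measure.ae_ne volume 0)

/-- Piecewise powers of `|x|`, with exponents `a` near the origin and `b` near infinity. -/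
noncomputable def powerEnvelope (c A B a b r : ℝ) : ℝ := if r ≤ c then A * r ^ a else B * r ^ b

lemma hasIntegral_powerEnvelope {α c a b : ℝ} (A B : ℝ) (hc : 0 < c) (ha : α < a) (hb : b < α) :
    IntegrableOn (fun r : ℝ => r ^ (-α - 1) * powerEnvelope c A B a b r) (Set.Ioi 0) ∧
    ∫ r in Set.Ioi (0 : ℝ), r ^ (-α - 1) * powerEnvelope c A B a b r =
      A * (c ^ (a - α) / (a - α)) + B * (c ^ (b - α) / (α - b)) := by
  have eq1 : Set.EqOn (fun r : ℝ => A * r ^ (a - α - 1))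
      (fun r : ℝ => r ^ (-α - 1) * powerEnvelope c A B a b r) (Set.Ioc 0 c) := by
    intro r hr
    simp only [powerEnvelope, if_pos hr.2]
    rw [mul_left_comm, ← Real.rpow_add hr.1]
    ring_nf
  have eq2 : Set.EqOn (fun r : ℝ => B * r ^ (b - α - 1))
      (fun r : ℝ => r ^ (-α - 1) * powerEnvelope c A B a b r) (Set.Ioi c) := by
    intro r hr
    simp only [powerEnvelope, if_neg (not_le.mpr (Set.mem_Ioi.mp hr))]
    rw [mul_left_comm, ← Real.rpow_add (hc.trans hr)]
    ring_nf
  have i1 : IntegrableOn (fun r : ℝ => A * r ^ (a - α - 1)) (Set.Ioc 0 c) := by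
    have h := (intervalIntegral.intervalIntegrable_rpow' (a := 0) (b := c)
      (show -1 < a - α - 1 by linarith)).const_mul A
    rwa [intervalIntegrable_iff_integrableOn_Ioc_of_le hc.le] at h
  have i2 : IntegrableOn (fun r : ℝ => B * r ^ (b - α - 1)) (Set.Ioi c) :=
    (integrableOn_Ioi_rpow_of_lt (by linarith) hc).const_mul B
  have i1' := i1.congr_fun eq1 measurableSet_Ioc
  have i2' := i2.congr_fun eq2 measurableSet_Ioi
  rw [← Set.Ioc_union_Ioi_eq_Ioi hc.le]
  refine ⟨i1'.union i2', ?_⟩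
  rw [setIntegral_union (Set.Ioc_disjoint_Ioi le_rfl) measurableSet_Ioi i1' i2',
    ← setIntegral_congr_fun measurableSet_Ioc eq1, ← setIntegral_congr_fun measurableSet_Ioi eq2,
    integral_const_mul, integral_const_mul, integral_Ioi_rpow_of_lt (by linarith) hc,
    ← intervalIntegral.integral_of_le hc.le, integral_rpow (Or.inl (by linarith))]
  have h1 : a - α - 1 + 1 = a - α := by ring
  have h2 : b - α - 1 + 1 = -(α - b) := by ring
  rw [h1, h2, Real.zero_rpow (by linarith), sub_zero, neg_div_neg_eq, neg_sub]

lemma integrable_powerEnvelope {α c a b : ℝ} (A B : ℝ) (hc : 0 < c) (ha : α < a) (hb : b < α) :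
    Integrable (fun x => powerEnvelope c A B a b |x|) (symmLevyMeasure α) :=
  integrable_symmLevyMeasure_iff.mpr
    (integrable_comp_abs (hasIntegral_powerEnvelope A B hc ha hb).1)

lemma integral_powerEnvelope {α c a b : ℝ} (A B : ℝ) (hc : 0 < c) (ha : α < a) (hb : b < α) :
    ∫ x, powerEnvelope c A B a b |x| ∂symmLevyMeasure α =
      2 * (A * (c ^ (a - α) / (a - α)) + B * (c ^ (b - α) / (α - b))) := by
  rw [integral_symmLevyMeasure, ← (hasIntegral_powerEnvelope A B hc ha hb).2]
  exact integral_comp_abs (f := fun r => r ^ (-α - 1) * powerEnvelope c A B a b r)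

/-- The tail mass of the Lévy measure. -/
lemma symmLevyMeasure_le_abs {α c : ℝ} (hα : 0 < α) (hc : 0 < c) :
    symmLevyMeasure α {x | c ≤ |x|} = ENNReal.ofReal (2 / (α * c ^ α)) := by
  have hset : symmLevyMeasure α {x | c ≤ |x|} = symmLevyMeasure α {x | c < |x|} := by
    refine measure_congr ?_
    have h : ∀ᵐ x ∂symmLevyMeasure α, x ∉ ({c, -c} : Set ℝ) :=
      (withDensity_absolutelyContinuous _ _).ae_le
        ((Set.toFinite ({c, -c} : Set ℝ)).countable.ae_notMem volume)
    filter_upwards [h] with x hx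
    refine propext ⟨fun h => lt_of_le_of_ne h fun h' => hx ?_, fun h => le_of_lt h⟩
    rcases eq_or_eq_neg_of_abs_eq h'.symm with h | h <;> simp [h]
  have hm : MeasurableSet {x : ℝ | c < |x|} := measurableSet_lt measurable_const (by fun_prop)
  -- The inner coefficient is 0, so α + 1 is an arbitrary exponent above α.
  have hfun : (fun x => powerEnvelope c 0 1 (α + 1) 0 |x|) =
      Set.indicator {x : ℝ | c < |x|} (1 : ℝ → ℝ) := by
    ext x
    by_cases hx : |x| ≤ c
    · simp [powerEnvelope, hx]
    · simp [powerEnvelope, hx, not_le.mp hx]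
  have hi := integrable_powerEnvelope (α := α) 0 1 hc (by linarith : α < α + 1) hα
  have hv := integral_powerEnvelope (α := α) 0 1 hc (by linarith : α < α + 1) hα
  rw [hfun] at hi hv
  have hfin : symmLevyMeasure α {x | c < |x|} ≠ ⊤ := by
    have : IntegrableOn (fun _ => (1 : ℝ)) _ _ := (integrable_indicator_iff hm).mp hi
    simpa using ((integrableOn_const_iff (by simp)).mp this).resolve_left (by simp) |>.ne
  rw [integral_indicator_one hm] at hv
  rw [hset, ← ENNReal.ofReal_toReal hfin]
  congr 1
  rw [← Measure.real, hv, zero_sub, sub_zero, Real.rpow_neg hc.le]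
  have := (Real.rpow_pos_of_pos hc α).ne'
  field_simp
  ring

/-! ### The Lévy–Khintchine exponent -/

lemma integral_eq_of_add_neg_eq {m : Measure ℝ} [m.IsNegInvariant] {f g : ℝ → ℂ}
    (hf : Integrable f m) (hfg : ∀ x, f x + f (-x) = 2 * g x) :
    ∫ x, f x ∂m = ∫ x, g x ∂m := by
  have h : ∫ x, (f x + f (-x)) ∂m = 2 * ∫ x, f x ∂m := by
    rw [integral_add hf hf.comp_neg, integral_neg_eq_self f m, two_mul]
  simp_rw [hfg, integral_const_mul] at h
  exact (mul_left_cancel₀ two_ne_zero h).symm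

lemma one_sub_cos_le_powerEnvelope (c t x : ℝ) :
    1 - Real.cos (t * x) ≤ powerEnvelope c (t ^ 2 / 2) 2 2 0 |x| := by
  unfold powerEnvelope
  split_ifs
  · have h := Real.one_sub_sq_div_two_le_cos (x := t * x)
    rw [Real.rpow_two, sq_abs]
    linarith [mul_pow t x 2]
  · have h := Real.neg_one_le_cos (t * x)
    rw [Real.rpow_zero]
    linarith

lemma integrable_one_sub_cos {α : ℝ} (h0 : 0 < α) (h2 : α < 2) (t : ℝ) :
    Integrable (fun x => 1 - Real.cos (t * x)) (symmLevyMeasure α) := by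
  refine (integrable_powerEnvelope (t ^ 2 / 2) 2 one_pos h2 h0).mono'
    (by fun_prop) (Filter.Eventually.of_forall fun x => ?_)
  rw [Real.norm_of_nonneg (sub_nonneg.mpr (Real.cos_le_one _))]
  exact one_sub_cos_le_powerEnvelope 1 t x

/-- The (negated) Lévy–Khintchine exponent `∫ (1 - cos (t x)) ν(dx)`. -/
noncomputable def levyExponent (α t : ℝ) : ℝ :=
  ∫ x, (1 - Real.cos (t * x)) ∂symmLevyMeasure α

lemma levyExponent_nonneg (α t : ℝ) : 0 ≤ levyExponent α t :=
  integral_nonneg fun _ => sub_nonneg.mpr (Real.cos_le_one _)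

lemma levyExponent_neg (α t : ℝ) : levyExponent α (-t) = levyExponent α t := by
  simp [levyExponent]

lemma norm_exp_I_mul_sub_one_le_two (x : ℝ) : ‖Complex.exp (Complex.I * x) - 1‖ ≤ 2 := by
  refine (norm_sub_le _ _).trans ?_
  rw [mul_comm, Complex.norm_exp_ofReal_mul_I, norm_one]
  norm_num

lemma integrable_stableKernel {α : ℝ} (hα : α ∈ Set.Ioo (0 : ℝ) 1 ∪ Set.Ioo (1 : ℝ) 2) (t : ℝ) :
    Integrable (stableKernel α t) (symmLevyMeasure α) := by
  have hmeas : AEStronglyMeasurable (stableKernel α t) (symmLevyMeasure α) := by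
    unfold stableKernel
    split_ifs <;> fun_prop
  rcases hα with ⟨h0, h1⟩ | ⟨h1, h2⟩
  · refine (integrable_powerEnvelope |t| 2 one_pos h1 h0).mono' hmeas
      (Filter.Eventually.of_forall fun x => ?_)
    have hI : Complex.I * t * x = Complex.I * (t * x : ℝ) := by push_cast; ring
    simp only [stableKernel, if_pos h1, powerEnvelope, Real.rpow_one, Real.rpow_zero, mul_one, hI]
    split_ifs
    · refine Real.norm_exp_I_mul_ofReal_sub_one_le.trans ?_
      rw [Real.norm_eq_abs, abs_mul]
    · exact norm_exp_I_mul_sub_one_le_two _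
  · rcases eq_or_ne t 0 with rfl | ht
    · have : stableKernel α 0 = 0 := by
        ext x
        simp [stableKernel]
      rw [this]
      exact integrable_zero _ _ _
    have ht' : 0 < |t| := abs_pos.mpr ht
    -- For |tx| ≤ 1 the second-order Taylor bound applies; for |tx| > 1 the bound 2 + |tx| is at
    -- most 3|tx|.
    refine (integrable_powerEnvelope (t ^ 2) (3 * |t|) (inv_pos.mpr ht') h2 h1).mono' hmeas
      (Filter.Eventually.of_forall fun x => ?_)
    have hI : Complex.I * t * x = Complex.I * (t * x : ℝ) := by push_cast; ring
    have hn : ‖Complex.I * (t * x : ℝ)‖ = |t| * |x| := by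
      rw [norm_mul, Complex.norm_I, one_mul, Complex.norm_real, Real.norm_eq_abs, abs_mul]
    simp only [stableKernel, if_neg h1.not_gt, powerEnvelope, Real.rpow_one, Real.rpow_two, hI]
    split_ifs with hx
    · have hle : |t| * |x| ≤ 1 := by
        calc |t| * |x| ≤ |t| * |t|⁻¹ := by gcongr
          _ = 1 := mul_inv_cancel₀ ht'.ne'
      refine (Complex.norm_exp_sub_one_sub_id_le (by rw [hn]; exact hle)).trans ?_
      rw [hn, mul_pow, sq_abs t]
    · have hlt : 1 < |t| * |x| := by
        calc 1 = |t| * |t|⁻¹ := (mul_inv_cancel₀ ht'.ne').symm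
          _ < |t| * |x| := by gcongr; exact not_le.mp hx
      refine (norm_sub_le _ _).trans ?_
      rw [hn]
      linarith [norm_exp_I_mul_sub_one_le_two (t * x)]

lemma exp_I_mul_add_exp_neg (x : ℝ) :
    Complex.exp (Complex.I * x) + Complex.exp (-(Complex.I * x)) = 2 * (Real.cos x : ℝ) := by
  rw [Complex.ofReal_cos, Complex.two_cos]
  ring_nf

lemma integral_stableKernel {α : ℝ} (hα : α ∈ Set.Ioo (0 : ℝ) 1 ∪ Set.Ioo (1 : ℝ) 2) (t : ℝ) :
    ∫ x, stableKernel α t x ∂symmLevyMeasure α = -(levyExponent α t : ℂ) := by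
  rw [levyExponent, ← Complex.ofReal_neg, ← integral_neg, ← integral_complex_ofReal]
  refine integral_eq_of_add_neg_eq (integrable_stableKernel hα t) fun x => ?_
  have h := exp_I_mul_add_exp_neg (t * x)
  have hI : Complex.I * (t * x : ℝ) = Complex.I * t * x := by push_cast; ring
  rw [hI] at h
  unfold stableKernel
  split_ifs
  · push_cast at h ⊢
    rw [mul_neg]
    linear_combination h
  · push_cast at h ⊢
    rw [mul_neg]
    linear_combination h

/-- A growth bound on the exponent for `α < 1`. -/
lemma levyExponent_le {α : ℝ} (h0 : 0 < α) (h1 : α < 1) (t : ℝ) :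
    levyExponent α t ≤ 4 / α * |t| ^ α := by
  rcases eq_or_ne t 0 with rfl | ht
  · simp [levyExponent, Real.zero_rpow h0.ne']
  have ht' : 0 < |t| := abs_pos.mpr ht
  -- At |x| = 2/|t| the bounds t²x²/2 and 2 coincide.
  have hc : 0 < 2 / |t| := by positivity
  have h2 : α < 2 := by linarith
  have hle : levyExponent α t ≤ ∫ x, powerEnvelope (2 / |t|) (t ^ 2 / 2) 2 2 0 |x|
      ∂symmLevyMeasure α :=
    integral_mono (integrable_one_sub_cos h0 h2 t) (integrable_powerEnvelope _ _ hc h2 h0)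
      fun x => one_sub_cos_le_powerEnvelope _ t x
  refine hle.trans ?_
  rw [integral_powerEnvelope _ _ hc h2 h0]
  -- Bernoulli's inequality absorbs the leftover factor 2^(1-α)/(2-α).
  have hB : (2 : ℝ) ^ (1 - α) ≤ 2 - α := by
    have := rpow_one_add_le_one_add_mul_self (s := 1) (by norm_num) (p := 1 - α)
      (by linarith) (by linarith)
    norm_num at this
    linarith
  have e1 : (2 / |t|) ^ (2 - α) = 2 * 2 ^ (1 - α) * |t| ^ α / t ^ 2 := by
    rw [Real.div_rpow (by norm_num) ht'.le, Real.rpow_sub ht', Real.rpow_two, sq_abs,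
      show (2 : ℝ) - α = 1 + (1 - α) by ring, Real.rpow_add two_pos, Real.rpow_one]
    have := (Real.rpow_pos_of_pos ht' α).ne'
    field_simp
  have e2 : (2 / |t|) ^ (0 - α) = 2 ^ (1 - α) * |t| ^ α / 2 := by
    rw [Real.div_rpow (by norm_num) ht'.le, zero_sub, Real.rpow_neg ht'.le, Real.rpow_neg two_pos.le,
      Real.rpow_sub two_pos, Real.rpow_one]
    have := (Real.rpow_pos_of_pos ht' α).ne'
    field_simp
  rw [e1, e2, sub_zero]
  have hα2 : 0 < 2 - α := by linarith
  have e3 : 2 * (t ^ 2 / 2 * (2 * 2 ^ (1 - α) * |t| ^ α / t ^ 2 / (2 - α)) +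
      2 * (2 ^ (1 - α) * |t| ^ α / 2 / α)) =
      4 / α * |t| ^ α * (2 ^ (1 - α) / (2 - α)) := by
    field_simp
    ring
  rw [e3]
  exact mul_le_of_le_one_right (by positivity) ((div_le_one hα2).mpr hB)

/-! ### Symmetry and tails from the characteristic function -/

/-- A finite measure on the line with even characteristic function is symmetric. -/
lemma isNegInvariant_of_charFun_neg {μ : Measure ℝ} [IsFiniteMeasure μ]
    (h : ∀ t, charFun μ (-t) = charFun μ t) : μ.IsNegInvariant := by
  constructor
  have hneg : μ.neg = μ.map ((-1 : ℝ) * ·) := by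
    rw [Measure.neg]
    congr 1
    ext x
    simp
  rw [hneg]
  refine Measure.ext_of_charFun (funext fun t => ?_)
  rw [charFun_map_mul, neg_one_mul, h]

/-- A tail bound from a power bound on the characteristic function at the origin. -/
lemma measureReal_abs_gt_le_of_charFun {μ : Measure ℝ} [IsProbabilityMeasure μ] {α C r : ℝ}
    (h0 : 0 < α) (h1 : α < 1) (hr : 0 < r) (hC : 0 ≤ C)
    (h : ∀ t, ‖1 - charFun μ t‖ ≤ C * |t| ^ α) :
    μ.real {x | r < |x|} ≤ 2 * C / r ^ α := by
  refine (measureReal_abs_gt_le_integral_charFun hr).trans ?_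
  have hu : 0 < 2 * r⁻¹ := by positivity
  have hI : IntervalIntegrable (fun t : ℝ => C * |t| ^ α) volume (-2 * r⁻¹) (2 * r⁻¹) := by
    refine Continuous.intervalIntegrable ?_ _ _
    exact continuous_const.mul (continuous_abs.rpow_const fun _ => Or.inr h0.le)
  have hint : ∫ t in (-2 * r⁻¹)..(2 * r⁻¹), C * |t| ^ α =
      2 * (C * ((2 * r⁻¹) ^ (α + 1) / (α + 1))) := by
    have hpos : ∫ t in (0 : ℝ)..(2 * r⁻¹), C * |t| ^ α =
        C * ((2 * r⁻¹) ^ (α + 1) / (α + 1)) := by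
      rw [intervalIntegral.integral_congr (g := fun t => C * t ^ α),
        intervalIntegral.integral_const_mul, integral_rpow (Or.inl (by linarith)),
        Real.zero_rpow (by linarith), sub_zero]
      intro t ht
      rw [Set.uIcc_of_le hu.le] at ht
      simp only [abs_of_nonneg ht.1]
    have hneg : ∫ t in (-2 * r⁻¹)..(0 : ℝ), C * |t| ^ α =
        ∫ t in (0 : ℝ)..(2 * r⁻¹), C * |t| ^ α := by
      have := intervalIntegral.integral_comp_neg (a := 0) (b := 2 * r⁻¹)
        (fun t : ℝ => C * |t| ^ α)
      simp only [abs_neg, neg_zero] at this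
      rw [this, neg_mul]
    have hcont : Continuous fun t : ℝ => C * |t| ^ α :=
      continuous_const.mul (continuous_abs.rpow_const fun _ => Or.inr h0.le)
    rw [← intervalIntegral.integral_add_adjacent_intervals (b := 0)
      (hcont.intervalIntegrable _ _) (hcont.intervalIntegrable _ _), hneg, hpos]
    ring
  have hle : ‖∫ t in (-2 * r⁻¹)..(2 * r⁻¹), 1 - charFun μ t‖ ≤
      2 * (C * ((2 * r⁻¹) ^ (α + 1) / (α + 1))) := by
    rw [← hint]
    exact intervalIntegral.norm_integral_le_of_norm_le (by linarith)
      (Eventually.of_forall fun t _ => h t) hI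
  have hB : (2 : ℝ) ^ α ≤ α + 1 := by
    have := rpow_one_add_le_one_add_mul_self (s := 1) (by norm_num) h0.le h1.le
    norm_num at this
    linarith
  have hrα : 0 < r ^ α := Real.rpow_pos_of_pos hr α
  calc 2⁻¹ * r * ‖∫ t in (-2 * r⁻¹)..(2 * r⁻¹), 1 - charFun μ t‖
      ≤ 2⁻¹ * r * (2 * (C * ((2 * r⁻¹) ^ (α + 1) / (α + 1)))) := by gcongr
    _ = 2 * C / r ^ α * (2 ^ α / (α + 1)) := by
      rw [Real.rpow_add hu, Real.rpow_one, Real.mul_rpow two_pos.le (inv_nonneg.mpr hr.le),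
        Real.inv_rpow hr.le]
      field_simp
    _ ≤ 2 * C / r ^ α :=
      mul_le_of_le_one_right (by positivity) ((div_le_one (by linarith)).mpr hB)

/-- For a symmetric law the two-sided tail is twice the one-sided tail. -/
lemma measureReal_le_abs_eq_two_mul {μ : Measure ℝ} [IsFiniteMeasure μ] [μ.IsNegInvariant] {y : ℝ}
    (hy : 0 < y) : μ.real {x | y ≤ |x|} = 2 * μ.real {x | y ≤ x} := by
  have hset : {x : ℝ | y ≤ |x|} = {x | y ≤ x} ∪ Neg.neg ⁻¹' {x | y ≤ x} := by
    ext x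
    exact le_abs (a := y) (b := x)
  have hm : MeasurableSet {x : ℝ | y ≤ x} := measurableSet_Ici
  have hd : Disjoint {x : ℝ | y ≤ x} (Neg.neg ⁻¹' {x : ℝ | y ≤ x}) := by
    rw [Set.disjoint_left]
    intro x (h1 : y ≤ x) (h2 : y ≤ -x)
    linarith
  rw [hset, measureReal_union hd (measurable_neg hm), two_mul]
  congr 1
  rw [Measure.real, Measure.measure_preimage_neg, Measure.real]

/-! ### Approximation by sums of cut-off jumps -/

/-- The radius outside of which the Lévy measure has mass `n`. -/
noncomputable def cutoffRadius (α : ℝ) (n : ℕ) : ℝ := (2 / (α * n)) ^ α⁻¹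

/-- The Lévy measure restricted to the complement of the cut-off interval, normalized. -/
noncomputable def cutoffLaw (α : ℝ) (n : ℕ) : Measure ℝ :=
  (n : ENNReal)⁻¹ • (symmLevyMeasure α).restrict {x | cutoffRadius α n ≤ |x|}

lemma cutoffRadius_pos {α : ℝ} (h0 : 0 < α) {n : ℕ} (hn : 0 < n) : 0 < cutoffRadius α n := by
  unfold cutoffRadius
  positivity

lemma tendsto_cutoffRadius {α : ℝ} (h0 : 0 < α) :
    Tendsto (cutoffRadius α) atTop (𝓝 0) := by
  have h : Tendsto (fun n : ℕ => 2 / (α * (n : ℝ))) atTop (𝓝 0) :=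
    tendsto_const_nhds.div_atTop (tendsto_natCast_atTop_atTop.const_mul_atTop h0)
  have h2 := h.rpow_const (p := α⁻¹) (Or.inr (by positivity))
  rwa [Real.zero_rpow (by positivity)] at h2

lemma symmLevyMeasure_cutoff {α : ℝ} (h0 : 0 < α) {n : ℕ} (hn : 0 < n) :
    symmLevyMeasure α {x | cutoffRadius α n ≤ |x|} = n := by
  rw [symmLevyMeasure_le_abs h0 (cutoffRadius_pos h0 hn), cutoffRadius,
    Real.rpow_inv_rpow (by positivity) h0.ne']
  have hn' : (0 : ℝ) < n := by exact_mod_cast hn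
  rw [show 2 / (α * (2 / (α * (n : ℝ)))) = n by field_simp]
  simp

lemma isProbabilityMeasure_cutoffLaw {α : ℝ} (h0 : 0 < α) {n : ℕ} (hn : 0 < n) :
    IsProbabilityMeasure (cutoffLaw α n) := by
  constructor
  rw [cutoffLaw, Measure.smul_apply, Measure.restrict_apply_univ, symmLevyMeasure_cutoff h0 hn,
    smul_eq_mul]
  exact ENNReal.inv_mul_cancel (by exact_mod_cast hn.ne') (by simp)

lemma isNegInvariant_cutoffLaw (α : ℝ) (n : ℕ) : (cutoffLaw α n).IsNegInvariant := by
  have := isNegInvariant_restrict (symmLevyMeasure α) (measurableSet_le_abs (cutoffRadius α n))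
    (by simp)
  exact isNegInvariant_smul _ _

/-- The exponent of the cut-off Lévy measure. -/
noncomputable def cutoffExponent (α : ℝ) (n : ℕ) (t : ℝ) : ℝ :=
  ∫ x in {x | cutoffRadius α n ≤ |x|}, (1 - Real.cos (t * x)) ∂symmLevyMeasure α

/-- The shape 1 + z_n/n, with z_n convergent, lets the n-th power tend to an exponential. -/
lemma charFun_cutoffLaw {α : ℝ} (h0 : 0 < α) {n : ℕ} (hn : 0 < n) (t : ℝ) :
    charFun (cutoffLaw α n) t = 1 + ((-cutoffExponent α n t / n : ℝ) : ℂ) := by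
  have hn' : (n : ℝ) ≠ 0 := by exact_mod_cast hn.ne'
  have := isProbabilityMeasure_cutoffLaw h0 hn
  have := isNegInvariant_cutoffLaw α n
  have hcos : charFun (cutoffLaw α n) t =
      ((∫ x, Real.cos (t * x) ∂cutoffLaw α n : ℝ) : ℂ) := by
    rw [charFun_apply_real, ← integral_complex_ofReal]
    refine integral_eq_of_add_neg_eq ?_ fun x => ?_
    · refine (integrable_const (1 : ℝ)).mono' (by fun_prop) (Eventually.of_forall fun x => ?_)
      rw [← Complex.ofReal_mul, Complex.norm_exp_ofReal_mul_I]
    · rw [← exp_I_mul_add_exp_neg (t * x)]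
      push_cast
      ring_nf
  have hint : ∫ x, (1 - Real.cos (t * x)) ∂cutoffLaw α n = cutoffExponent α n t / n := by
    rw [cutoffLaw, integral_smul_measure, cutoffExponent]
    simp [div_eq_inv_mul]
  have hI : Integrable (fun x => Real.cos (t * x)) (cutoffLaw α n) :=
    (integrable_const (1 : ℝ)).mono' (by fun_prop)
      (Eventually.of_forall fun x => by simpa using Real.abs_cos_le_one (t * x))
  rw [integral_sub (integrable_const 1) hI] at hint
  simp only [integral_const, probReal_univ, smul_eq_mul, mul_one] at hint
  rw [hcos, ← Complex.ofReal_one, ← Complex.ofReal_add]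
  congr 1
  rw [neg_div, ← hint]
  ring

lemma tendsto_cutoffExponent {α : ℝ} (h0 : 0 < α) (h2 : α < 2) (t : ℝ) :
    Tendsto (fun n => cutoffExponent α n t) atTop (𝓝 (levyExponent α t)) := by
  have hm : ∀ n, MeasurableSet {x : ℝ | cutoffRadius α n ≤ |x|} := fun n =>
    measurableSet_le_abs _
  simp_rw [cutoffExponent, ← integral_indicator (hm _)]
  refine tendsto_integral_of_dominated_convergence (fun x => 1 - Real.cos (t * x))
    (fun n => AEStronglyMeasurable.indicator (by fun_prop) (hm n)) (integrable_one_sub_cos h0 h2 t)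
    (fun n => Eventually.of_forall fun x => ?_) ?_
  · refine (norm_indicator_le_norm_self _ _).trans ?_
    rw [Real.norm_of_nonneg (sub_nonneg.mpr (Real.cos_le_one _))]
  · filter_upwards [ae_ne_zero_symmLevyMeasure α] with x hx
    refine tendsto_const_nhds.congr' ?_
    filter_upwards [(tendsto_cutoffRadius h0).eventually_lt_const (abs_pos.mpr hx)] with n hn
    have hx : x ∈ {x | cutoffRadius α n ≤ |x|} := hn.le
    exact (Set.indicator_of_mem hx fun x => 1 - Real.cos (t * x)).symm

lemma cutoffLaw_abs_lt {α y : ℝ} (h0 : 0 < α) (hy : 0 < y) {n : ℕ} (hn : 0 < n)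
    (hny : cutoffRadius α n ≤ y) :
    cutoffLaw α n {x | y ≤ |x|}ᶜ = ENNReal.ofReal (1 + -(2 / (α * y ^ α)) / n) := by
  have := isProbabilityMeasure_cutoffLaw h0 hn
  have hn' : (0 : ℝ) < n := by exact_mod_cast hn
  have hF : cutoffLaw α n {x | y ≤ |x|} = ENNReal.ofReal (2 / (α * y ^ α) / n) := by
    have hsub : {x : ℝ | y ≤ |x|} ⊆ {x | cutoffRadius α n ≤ |x|} := fun x hx => hny.trans hx
    rw [cutoffLaw, Measure.smul_apply, Measure.restrict_apply (measurableSet_le_abs y),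
      Set.inter_eq_left.mpr hsub, symmLevyMeasure_le_abs h0 hy,
      smul_eq_mul, mul_comm, ENNReal.ofReal_div_of_pos hn', ENNReal.ofReal_natCast,
      ENNReal.div_eq_inv_mul, mul_comm]
  rw [prob_compl_eq_one_sub (measurableSet_le_abs y), hF, ← ENNReal.ofReal_one,
    ← ENNReal.ofReal_sub _ (by positivity), neg_div, sub_eq_add_neg]

/-- The tail of a symmetric stable law dominates half the probability of a jump of size `y`. -/
lemma one_le_two_mul_measure_le_abs_add_exp {α y : ℝ} (h0 : 0 < α) (h2 : α < 2) (hy : 0 < y)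
    (μ : Measure ℝ) [IsProbabilityMeasure μ]
    (hμ : ∀ t, charFun μ t = Complex.exp (-(levyExponent α t : ℂ))) :
    1 ≤ 2 * μ {x | y ≤ |x|} + ENNReal.ofReal (Real.exp (-(2 / (α * y ^ α)))) := by
  set l := 2 / (α * y ^ α) with hl
  -- The shift to n + 1 avoids n = 0, where the normalizing factor is infinite.
  have hprob : ∀ n, IsProbabilityMeasure (convPow (cutoffLaw α (n + 1)) (n + 1)) := fun n =>
    have := isProbabilityMeasure_cutoffLaw h0 n.succ_pos
    inferInstance
  let ms : ℕ → ProbabilityMeasure ℝ := fun n => ⟨convPow (cutoffLaw α (n + 1)) (n + 1), hprob n⟩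
  let m0 : ProbabilityMeasure ℝ := ⟨μ, inferInstance⟩
  have hlim : Tendsto ms atTop (𝓝 m0) := by
    refine ProbabilityMeasure.tendsto_of_tendsto_charFun fun t => ?_
    have h1 : Tendsto (fun n : ℕ => (1 + ((-cutoffExponent α n t / n : ℝ) : ℂ)) ^ n) atTop
        (𝓝 (Complex.exp (-(levyExponent α t : ℂ)))) := by
      refine Complex.tendsto_one_add_pow_exp_of_tendsto ?_
      have h3 := (Complex.continuous_ofReal.tendsto _).comp (tendsto_cutoffExponent h0 h2 t).neg
      rw [Complex.ofReal_neg] at h3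
      refine h3.congr' ?_
      filter_upwards [eventually_gt_atTop 0] with n hn
      have hn' : (n : ℂ) ≠ 0 := by exact_mod_cast hn.ne'
      simp only [Function.comp_apply]
      push_cast
      field_simp
    have h4 := h1.comp (tendsto_add_atTop_nat 1)
    change Tendsto (fun n => charFun (convPow (cutoffLaw α (n + 1)) (n + 1)) t) atTop
      (𝓝 (charFun μ t))
    rw [hμ]
    refine h4.congr fun n => ?_
    have := isProbabilityMeasure_cutoffLaw h0 n.succ_pos
    rw [charFun_convPow, charFun_cutoffLaw h0 n.succ_pos]
    rfl
  have hclosed : IsClosed {x : ℝ | y ≤ |x|} := isClosed_le continuous_const continuous_abs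
  have hlimsup := ProbabilityMeasure.limsup_measure_closed_le_of_tendsto hlim hclosed
  have hq : Tendsto (fun n : ℕ => ENNReal.ofReal ((1 - (1 + -l / (n + 1 : ℕ)) ^ (n + 1)) / 2)) atTop
      (𝓝 (ENNReal.ofReal ((1 - Real.exp (-l)) / 2))) := by
    refine (ENNReal.continuous_ofReal.tendsto _).comp ?_
    exact ((((Real.tendsto_one_add_div_pow_exp (-l)).comp
      (tendsto_add_atTop_nat 1)).const_sub 1).div_const 2)
  have hev : ∀ᶠ n : ℕ in atTop, ENNReal.ofReal ((1 - (1 + -l / (n + 1 : ℕ)) ^ (n + 1)) / 2) ≤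
      (ms n : Measure ℝ) {x | y ≤ |x|} := by
    have hr := (tendsto_cutoffRadius h0).comp (tendsto_add_atTop_nat 1)
    -- For n + 1 ≥ l the base 1 - l/(n + 1) is nonnegative, so `ENNReal.ofReal` commutes with the
    -- power.
    have hs := ((tendsto_natCast_atTop_atTop (R := ℝ)).comp
      (tendsto_add_atTop_nat 1)).eventually_ge_atTop l
    filter_upwards [hr.eventually_lt_const hy, hs] with n hn hnl
    have hn' : cutoffRadius α (n + 1) ≤ y := hn.le
    have hp := isProbabilityMeasure_cutoffLaw h0 n.succ_pos
    have hs := isNegInvariant_cutoffLaw α (n + 1)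
    have hd : (Measure.dirac (0 : ℝ)).IsNegInvariant := isNegInvariant_convPow (cutoffLaw α (n + 1)) 0
    have h := univ_le_two_mul_conv_convPow (y := y) (cutoffLaw α (n + 1)) (n + 1)
      (Measure.dirac 0)
    rw [Measure.dirac_zero_conv, measure_univ, one_mul,
      cutoffLaw_abs_lt h0 hy n.succ_pos hn'] at h
    have hnonneg : 0 ≤ 1 + -l / (n + 1 : ℕ) := by
      have : l / (n + 1 : ℕ) ≤ 1 := (div_le_one (by positivity)).mpr hnl
      rw [neg_div]
      linarith
    rw [← ENNReal.ofReal_pow hnonneg] at h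
    rw [ENNReal.ofReal_div_of_pos two_pos, ENNReal.ofReal_ofNat]
    refine ENNReal.div_le_of_le_mul ?_
    rw [ENNReal.ofReal_sub _ (by positivity), ENNReal.ofReal_one, mul_comm]
    exact tsub_le_iff_right.mpr h
  have hfin : ENNReal.ofReal ((1 - Real.exp (-l)) / 2) ≤ μ {x | y ≤ |x|} := by
    rw [← hq.limsup_eq]
    exact (limsup_le_limsup hev).trans hlimsup
  have hexp : Real.exp (-l) ≤ 1 := Real.exp_le_one_iff.mpr (by
    rw [neg_nonpos, hl]
    positivity)
  calc (1 : ENNReal) = 2 * ENNReal.ofReal ((1 - Real.exp (-l)) / 2) +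
        ENNReal.ofReal (Real.exp (-l)) := by
        rw [← ENNReal.ofReal_ofNat, ← ENNReal.ofReal_mul two_pos.le,
          ← ENNReal.ofReal_add (by linarith) (Real.exp_pos _).le, ← ENNReal.ofReal_one]
        congr 1
        ring
    _ ≤ _ := by gcongr

/-! ### The tail bounds -/

theorem theorem7 {Ω : Type*} [MeasurableSpace Ω] (P : Measure Ω) [IsProbabilityMeasure P]
    (α : ℝ) (hα : α ∈ Set.Ioo (0 : ℝ) 1 ∪ Set.Ioo (1 : ℝ) 2)
    (X : Ω → ℝ) (hX : IsSymmStable α X P) (y : ℝ) (hy : 0 < y) :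
    (α < 1 →
      P.real {ω | y ≤ X ω} ≤ 4 / (α * y ^ α) ∧
      P.real {ω | y < |X ω|} ≤ 8 / (α * y ^ α)) ∧
    1 / (2 * (2 + α * y ^ α)) ≤ P.real {ω | y ≤ X ω} := by
  have h0 : 0 < α := by rcases hα with h | h <;> linarith [h.1]
  have h2 : α < 2 := by rcases hα with h | h <;> linarith [h.2]
  set μ := P.map X with hμdef
  have hμp : IsProbabilityMeasure μ := Measure.isProbabilityMeasure_map hX.aemeasurable
  have hμ : ∀ t, charFun μ t = Complex.exp (-(levyExponent α t : ℂ)) := fun t => by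
    rw [hX.charFun_eq t, integral_stableKernel hα]
  have hsymm : μ.IsNegInvariant := isNegInvariant_of_charFun_neg fun t => by
    rw [hμ, hμ, levyExponent_neg]
  have hge : P.real {ω | y ≤ X ω} = μ.real {x | y ≤ x} :=
    (map_measureReal_apply_of_aemeasurable hX.aemeasurable measurableSet_Ici).symm
  have htwo := measureReal_le_abs_eq_two_mul (μ := μ) hy
  have hyα : 0 < y ^ α := Real.rpow_pos_of_pos hy α
  refine ⟨fun h1 => ?_, ?_⟩
  · have hbound : ∀ t, ‖1 - charFun μ t‖ ≤ 4 / α * |t| ^ α := fun t => by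
      have he : (1 : ℂ) - Complex.exp (-(levyExponent α t : ℂ)) =
          ((1 - Real.exp (-levyExponent α t) : ℝ) : ℂ) := by push_cast; rfl
      have hK := levyExponent_nonneg α t
      rw [hμ, he, Complex.norm_real, Real.norm_of_nonneg
        (sub_nonneg.mpr (Real.exp_le_one_iff.mpr (by linarith)))]
      linarith [Real.add_one_le_exp (-levyExponent α t), levyExponent_le h0 h1 t]
    have htail : ∀ r, 0 < r → μ.real {x | r < |x|} ≤ 8 / (α * r ^ α) := fun r hr => by
      refine (measureReal_abs_gt_le_of_charFun h0 h1 hr (by positivity) hbound).trans_eq ?_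
      field_simp
      norm_num
    -- The strict tail bound at r < y, with r ↑ y, covers the closed event; continuity of the bound
    -- keeps the constant.
    have htail' : μ.real {x | y ≤ |x|} ≤ 8 / (α * y ^ α) := by
      have hlim : Tendsto (fun r : ℝ => 8 / (α * r ^ α)) (𝓝[<] y) (𝓝 (8 / (α * y ^ α))) := by
        refine tendsto_nhdsWithin_of_tendsto_nhds (ContinuousAt.tendsto ?_)
        exact continuousAt_const.div
          (continuousAt_const.mul (Real.continuousAt_rpow_const _ _ (Or.inl hy.ne')))
          (by positivity)
      refine ge_of_tendsto hlim ?_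
      filter_upwards [Ioo_mem_nhdsLT hy] with r hr
      have hsub : {x : ℝ | y ≤ |x|} ⊆ {x | r < |x|} := fun x hx => hr.2.trans_le hx
      exact (measureReal_mono hsub).trans (htail r hr.1)
    refine ⟨?_, ?_⟩
    · rw [hge]
      have : 8 / (α * y ^ α) = 2 * (4 / (α * y ^ α)) := by ring
      linarith
    · have hm : MeasurableSet {x : ℝ | y < |x|} := measurableSet_lt measurable_const (by fun_prop)
      exact (map_measureReal_apply_of_aemeasurable hX.aemeasurable hm).symm.le.trans (htail y hy)
  · have h := one_le_two_mul_measure_le_abs_add_exp h0 h2 hy μ hμ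
    have hreal : 1 ≤ 2 * μ.real {x | y ≤ |x|} + Real.exp (-(2 / (α * y ^ α))) := by
      have h' := ENNReal.toReal_mono (by finiteness) h
      rw [ENNReal.toReal_add (by finiteness) (by finiteness), ENNReal.toReal_mul,
        ENNReal.toReal_ofReal (Real.exp_pos _).le] at h'
      simpa [Measure.real] using h'
    -- This is exp(l) ≥ 1 + l for l = 2/(α y^α), inverted.
    have hexp : Real.exp (-(2 / (α * y ^ α))) ≤ α * y ^ α / (2 + α * y ^ α) := by
      rw [Real.exp_neg, ← inv_div (2 + α * y ^ α)]
      have hle : (2 + α * y ^ α) / (α * y ^ α) ≤ Real.exp (2 / (α * y ^ α)) := by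
        refine le_trans (le_of_eq ?_) (Real.add_one_le_exp _)
        field_simp
      exact inv_anti₀ (by positivity) hle
    rw [hge]
    have hsum : 1 / (2 * (2 + α * y ^ α)) = (1 - α * y ^ α / (2 + α * y ^ α)) / 4 := by
      field_simp
      ring
    rw [hsum]
    linarith
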